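/- Let $k,n$ be integers with $n\ge 2k\ge 1$, let $V$ be a set with $|V|=n$, and let $V^{(k)}$ be the collection of $k$-element subsets of $V$. For weightings $w,u\in\mathbb R^{V^{(k)}}$ write $\langle w,u\rangle=\sum_{e\in V^{(k)}}w(e)u(e)$ and $d(w)=\binom nk^{-1}\sum_{e\in V^{(k)}}w(e)$; for a permutation $\pi$ of $V$ put $w_\pi(e)=w(\pi^{-1}e)$; and let $$\operatorname{disc}(w,u)=\max_{\pi}\Bigl|\langle w_\pi,u\rangle-d(w)d(u)\tbinom nk\Bigr|,$$ the maximum being over all permutations $\pi$ of $V$. The $W$-vector $(W_0,\dots,W_k)$ of $w$ is defined recursively: $W_0=|d(w)|$ and, for $1\le i\le k$, $$W_i=\frac1{n(n-1)}\sum_{x\ne y}W^{xy}_{i-1},$$ where the sum is over ordered pairs of distinct $x,y\in V$ and $(W^{xy}_0,\dots,W^{xy}_{k-1})$ is the $W$-vector of the weighting $w^{xy}(e)=w(e\cup\{x\})-w(e\cup\{y\})$ of the $(k-1)$-subsets $e$ of $V\setminus\{x,y\}$. Fix distinct vertices $x_1,y_1,\dots,x_k,y_k\in V$. For $0\le i\le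 k$ and $A\in V^{(k)}$ let $\phi_i(A)=(-1)^{|A\cap\{y_1,\dots,y_i\}|}$ if $|A\cap\{x_j,y_j\}|=1$ for all $1\le j\le i$, and $\phi_i(A)=0$ otherwise. Let $V_i\subseteq\mathbb R^{V^{(k)}}$ be the linear span of the weightings $(\phi_i)_\pi$, over all permutations $\pi$ of $V$. Then: (a) For $1\le i\le k$ and every $w\in\mathbb R^{V^{(k)}}$, $\operatorname{disc}(w,\phi_i)=0$ if and only if $w\in V_i^\perp$. (b) If $u\in V_i$ and $w\in V_j$, where $0\le i,j\le k$ and $i\ne j$, then $\operatorname{disc}(u,w)=0$. (c) $\mathbb R^{V^{(k)}}$ is the direct sum $V_0\oplus\cdots\oplus V_k$. (d) If $u=u_0+\cdots+u_k$ with $u_i\in V_i$ for each $i$, and $(U_0,\dots,U_k)$ is the $W$-vector of $u$, then for each $0\le i\le k$ we have $U_i=0$ if and only if $u_i=0$. (e) If $t\ge1$ and $w_1,\dots,w_t\in\mathbb R^{V^{(k)}}$ are nonzero with $\operatorname{disc}(w_i,w_j)=0$ for all $i\ne j$, then there are pairwise disjoint (possibly empty) sets $I_1,\dots,I_t$ with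 $I_1\cup\cdots\cup I_t=\{1,\dots,k\}$ such that $$w_i\in V_0\oplus\bigoplus_{h\in I_i}V_h\qquad\text{for each }1\le i\le t.$$ -/

import Mathlib

namespace WHyp

noncomputable section

universe u

/-- The space `ℝ^{V^{(k)}}` of weighted `k`-uniform hypergraphs `w : V^{(k)} → ℝ`, with its standard
inner product `⟨w, u⟩ = ∑ e, w e * u e`. -/
abbrev Weighting (V : Type u) [Fintype V] (k : ℕ) : Type u :=
  EuclideanSpace ℝ (Set.powersetCard V k)

/-- The weighted hypergraph `w_π`, given by `w_π(e) = w(π⁻¹ e)`. -/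
def permute {V : Type u} [Fintype V] {k : ℕ} (π : Equiv.Perm V) (w : Weighting V k) :
    Weighting V k :=
  WithLp.toLp 2 fun e => w (Set.powersetCard.map k (π⁻¹ : Equiv.Perm V).toEmbedding e)

/-- The density `d(w) = w(V) / C(n, k)`, where `w(V)` is the sum of all weights. -/
def density {V : Type u} [Fintype V] {k : ℕ} (w : Weighting V k) : ℝ :=
  (∑ e, w e) / ((Fintype.card V).choose k : ℝ)

/-- The discrepancy of a pair: `disc(w, u) = max_π |⟨w_π, u⟩ - d(w) d(u) C(n, k)|`. -/
def disc {V : Type u} [Fintype V] [DecidableEq V] {k : ℕ} (w u : Weighting V k) : ℝ :=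
  Finset.univ.sup' Finset.univ_nonempty fun π : Equiv.Perm V =>
    |inner ℝ (permute π w) u - density w * density u * ((Fintype.card V).choose k : ℝ)|

/-- For `e ⊆ V ∖ {x, y}` of size `k` and `z ∈ {x, y}`, the edge `e ∪ {z}` of size `k + 1`. -/
def addVertex {V : Type u} [DecidableEq V] {k : ℕ} {x y : V}
    (e : Set.powersetCard {v : V // v ≠ x ∧ v ≠ y} k) (z : V) (hz : z = x ∨ z = y) :
    Set.powersetCard V (k + 1) :=
  ⟨insert z (e.1.map (Function.Embedding.subtype _)), by
    have hnot : z ∉ e.1.map (Function.Embedding.subtype _) := by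
      intro h
      obtain ⟨a, -, ha⟩ := Finset.mem_map.1 h
      have ha' : a.1 = z := ha
      rcases hz with hz | hz
      · exact a.2.1 (ha'.trans hz)
      · exact a.2.2 (ha'.trans hz)
    change Finset.card _ = k + 1
    rw [Finset.card_insert_of_notMem hnot, Finset.card_map]
    exact congrArg (· + 1) e.2⟩

/-- The difference weighting `w^{xy}` on the `k`-subsets of `V ∖ {x, y}`, given by
`w^{xy}(e) = w(e ∪ {x}) - w(e ∪ {y})`. -/
def diffWeighting {V : Type u} [Fintype V] [DecidableEq V] {k : ℕ} (w : Weighting V (k + 1))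
    (x y : V) : Weighting {v : V // v ≠ x ∧ v ≠ y} k :=
  WithLp.toLp 2 fun e => w (addVertex e x (Or.inl rfl)) - w (addVertex e y (Or.inr rfl))

/-- The entry `W_i` of the `W`-vector `(W_0, …, W_k)` of `w`: `W_0 = |d(w)|`, and `W_{i+1}` is the
average of the entries `W_i^{xy}` of the `W`-vectors of the difference weightings `w^{xy}`, over all
ordered pairs of distinct vertices `x, y`. (Only `i ≤ k` is meaningful; other entries are `0`.) -/
def wVector : (i : ℕ) → {k : ℕ} → {V : Type u} → [Fintype V] → [DecidableEq V] →
    Weighting V k → ℝ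
  | 0, _, _, _, _, w => |density w|
  | _ + 1, 0, _, _, _, _ => 0
  | i + 1, _ + 1, V, _, _, w =>
      (∑ x : V, ∑ y : V, if x ≠ y then wVector i (diffWeighting w x y) else 0) /
        ((Fintype.card V : ℝ) * ((Fintype.card V : ℝ) - 1))

/-- The canonical weighting `φ_i` of a sequence `x_1, y_1, …, x_k, y_k` (indexed from `0` here, so
that `x_1, y_1, …, x_i, y_i` are the `x j, y j` with `j < i`): if `A` meets each of the pairs
`{x_j, y_j}`, `j ≤ i`, in exactly one vertex then `φ_i(A) = (-1)^{|A ∩ {y_1, …, y_i}|}`, and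
otherwise `φ_i(A) = 0`. -/
def phi {V : Type u} [Fintype V] [DecidableEq V] {k : ℕ} (x y : Fin k → V) (i : Fin (k + 1)) :
    Weighting V k :=
  WithLp.toLp 2 fun A =>
    if ∀ j : Fin k, (j : ℕ) < (i : ℕ) → (A.1 ∩ {x j, y j}).card = 1 then
      (-1 : ℝ) ^ (A.1 ∩ (Finset.univ.filter fun j : Fin k => (j : ℕ) < (i : ℕ)).image y).card
    else 0

/-- The subspace `V_i` spanned by all the permuted weightings `(φ_i)_π`. -/
def canonicalSpan {V : Type u} [Fintype V] [DecidableEq V] {k : ℕ} (x y : Fin k → V)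
    (i : Fin (k + 1)) : Submodule ℝ (Weighting V k) :=
  Submodule.span ℝ (Set.range fun π : Equiv.Perm V => permute π (phi x y i))

end

end WHyp

/-!
Write `p(x, y)` for the weighting `A ↦ ∏ l, (1[x l ∈ A] - 1[y l ∈ A])` of a sequence of `i` pairs,
so that `V_i` is the span of the orbit of one such weighting. Unfolding the recursion, `W_i(w) = 0`
says that `w` is orthogonal to every `p(x, y)` with `i` pairs, that is, to `V_i`. A weighting
orthogonal to all `V_i` vanishes, and swapping the vertices of a pair shows `V_i ⟂ V_j` for `i ≠ j`;
hence the `V_i` decompose the space orthogonally, and the `W`-vector detects the components.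

Up to constants, `disc(w, u) = 0` says that `w` is orthogonal to the span `M` of the orbit of `u`.
The symmetries of `p(x, y)` determine it up to a scalar, and its projection to `M` inherits them, so
this projection is a multiple of `p(x, y)`: either `u` is orthogonal to `V_i`, or `M` contains
`V_i` and `w` is orthogonal to `V_i`. So two weightings of discrepancy zero share no component
outside `V_0`.
-/

namespace WHyp

noncomputable section

universe u

section OrbitSpan

variable {𝕜 E G : Type*} [RCLike 𝕜] [NormedAddCommGroup E] [InnerProductSpace 𝕜 E] [Group G]
  (ρ : G →* (E ≃ₗᵢ[𝕜] E))

/-- The span of the orbit of `v` under the unitary representation `ρ`, i.e. the smallest invariant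
subspace containing `v`. For `ρ = permuteHom V k` and `v = φ_i` this is the paper's `V_i`. -/
def orbitSpan (v : E) : Submodule 𝕜 E :=
  Submodule.span 𝕜 (Set.range fun g => ρ g v)

/-- The vector `p` is determined, up to a scalar, by the elements of `G` that act on it as scalars
and by the scalars by which they act. Then any orthogonal projection of `p` to an invariant subspace
is a multiple of `p`. -/
def IsDeterminedBySymmetries (p : E) : Prop :=
  ∀ v : E, (∀ (g : G) (c : 𝕜), ρ g p = c • p → ρ g v = c • v) → v ∈ Submodule.span 𝕜 {p}

variable {ρ}

theorem apply_mem_orbitSpan (g : G) (v : E) : ρ g v ∈ orbitSpan ρ v :=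
  Submodule.subset_span ⟨g, rfl⟩

theorem self_mem_orbitSpan (v : E) : v ∈ orbitSpan ρ v := by
  simpa using apply_mem_orbitSpan (ρ := ρ) 1 v

theorem map_mem_orbitSpan (g : G) {u v : E} (hu : u ∈ orbitSpan ρ v) :
    ρ g u ∈ orbitSpan ρ v := by
  induction hu using Submodule.span_induction with
  | mem _ hu =>
    obtain ⟨h, rfl⟩ := hu
    simpa using apply_mem_orbitSpan (g * h) v
  | zero => simp
  | add _ _ _ _ hu hu' => simpa using Submodule.add_mem _ hu hu'
  | smul c _ _ hu => simpa using Submodule.smul_mem _ c hu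

theorem orbitSpan_le_orbitSpan {u v : E} (hu : u ∈ orbitSpan ρ v) :
    orbitSpan ρ u ≤ orbitSpan ρ v :=
  Submodule.span_le.2 <| Set.range_subset_iff.2 fun g => map_mem_orbitSpan g hu

theorem mem_orthogonal_orbitSpan_iff {u v : E} :
    u ∈ (orbitSpan ρ v)ᗮ ↔ ∀ g, inner 𝕜 (ρ g v) u = 0 := by
  rw [orbitSpan, ← Submodule.span_singleton_le_iff_mem, ← Submodule.isOrtho_iff_le,
    Submodule.isOrtho_comm, Submodule.isOrtho_span]
  simp

theorem inner_apply_left (g : G) (u v : E) : inner 𝕜 (ρ g u) v = inner 𝕜 u (ρ g⁻¹ v) := by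
  rw [← (ρ g).inner_map_map u (ρ g⁻¹ v)]
  simp

theorem mem_orthogonal_orbitSpan_comm {u v : E} :
    u ∈ (orbitSpan ρ v)ᗮ ↔ v ∈ (orbitSpan ρ u)ᗮ := by
  simp only [mem_orthogonal_orbitSpan_iff, inner_apply_left _ v, inner_eq_zero_symm (x := v)]
  exact (Equiv.inv G).forall_congr_right (q := fun g => inner 𝕜 (ρ g u) v = 0)

theorem map_starProjection_orbitSpan (g : G) (u v : E)
    [(orbitSpan ρ v).HasOrthogonalProjection] :
    ρ g ((orbitSpan ρ v).starProjection u) = (orbitSpan ρ v).starProjection (ρ g u) := by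
  refine (Submodule.eq_starProjection_of_mem_of_inner_eq_zero
    (map_mem_orbitSpan g (Submodule.starProjection_apply_mem _ u)) fun m hm => ?_).symm
  rw [← map_sub, inner_apply_left]
  exact Submodule.starProjection_inner_eq_zero u _ (map_mem_orbitSpan g⁻¹ hm)

theorem mem_orthogonal_orbitSpan_or_orbitSpan_le {p : E} (hp : IsDeterminedBySymmetries ρ p)
    (w : E) [(orbitSpan ρ w).HasOrthogonalProjection] :
    w ∈ (orbitSpan ρ p)ᗮ ∨ orbitSpan ρ p ≤ orbitSpan ρ w := by
  obtain ⟨c, hc⟩ : ∃ c : 𝕜, c • p = (orbitSpan ρ w).starProjection p :=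
    Submodule.mem_span_singleton.1 <| hp _ fun g c hg => by
      rw [map_starProjection_orbitSpan, hg, map_smul]
  rcases eq_or_ne c 0 with rfl | hc0
  · left
    rw [mem_orthogonal_orbitSpan_comm, ← Submodule.starProjection_apply_eq_zero_iff, ← hc,
      zero_smul]
  · right
    refine orbitSpan_le_orbitSpan ((Submodule.smul_mem_iff _ hc0).1 ?_)
    exact hc ▸ Submodule.starProjection_apply_mem _ p

end OrbitSpan

section OrthogonalDecomposition

variable {𝕜 E κ : Type*} [RCLike 𝕜] [NormedAddCommGroup E] [InnerProductSpace 𝕜 E]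
  {U : κ → Submodule 𝕜 E}

theorem sum_mem_orthogonal_iff [Fintype κ] (hU : Pairwise fun i j => U i ⟂ U j) {c : κ → E}
    (hc : ∀ j, c j ∈ U j) (i : κ) : ∑ j, c j ∈ (U i)ᗮ ↔ c i = 0 := by
  classical
  have hrest : ∑ j ∈ Finset.univ.erase i, c j ∈ (U i)ᗮ :=
    Submodule.sum_mem _ fun j hj => hU (Finset.ne_of_mem_erase hj) (hc j)
  rw [← Finset.add_sum_erase _ _ (Finset.mem_univ i), Submodule.add_mem_iff_left _ hrest]
  exact ⟨fun hi => inner_self_eq_zero.1 ((Submodule.mem_orthogonal _ _).1 hi _ (hc i)),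
    fun hi => hi ▸ Submodule.zero_mem _⟩

theorem mem_of_forall_notMem_orthogonal_le [Finite κ] (hU : Pairwise fun i j => U i ⟂ U j)
    (htop : ⨆ j, U j = ⊤) {w : E} {M : Submodule 𝕜 E} (hM : ∀ j, w ∉ (U j)ᗮ → U j ≤ M) :
    w ∈ M := by
  cases nonempty_fintype κ
  obtain ⟨c, hc, hw⟩ := (Submodule.mem_iSup_iff_exists_finsupp U w).1 (htop ▸ Submodule.mem_top)
  rw [Finsupp.sum_fintype _ _ fun _ => rfl] at hw
  simp only [← hw, sum_mem_orthogonal_iff hU hc] at hM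
  rw [← hw]
  refine Submodule.sum_mem _ fun j _ => ?_
  rcases eq_or_ne (c j) 0 with hj | hj
  · rw [hj]
    exact Submodule.zero_mem _
  · exact hM j hj (hc j)

end OrthogonalDecomposition

open Finset Equiv

section Edges

variable {V : Type*} [DecidableEq V] {k : ℕ}

theorem mem_inv_smul_iff (π : Perm V) (A : Set.powersetCard V k) (v : V) :
    v ∈ (π⁻¹ • A).1 ↔ π v ∈ A.1 :=
  Finset.mem_inv_smul_finset_iff

theorem mem_swap_smul_iff (a b : V) (A : Set.powersetCard V k) (v : V) :
    v ∈ (swap a b • A).1 ↔ swap a b v ∈ A.1 := by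
  simpa using mem_inv_smul_iff (swap a b) A v

theorem swap_smul_eq_self {a b : V} {A : Set.powersetCard V k} (h : a ∈ A.1 ↔ b ∈ A.1) :
    swap a b • A = A := by
  ext v
  rw [mem_swap_smul_iff, swap_apply_def]
  grind

theorem swap_induction {B : Set.powersetCard V k} {P : Set.powersetCard V k → Prop} (base : P B)
    (step : ∀ A ≠ B, (∀ a ∈ A.1, a ∉ B.1 → ∀ b ∈ B.1, b ∉ A.1 → P (swap a b • A)) → P A)
    (A : Set.powersetCard V k) : P A := by
  induction hm : #(A.1 \ B.1) using Nat.strong_induction_on generalizing A with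
  | _ m ih =>
    rcases eq_or_ne A B with rfl | hAB
    · exact base
    refine step A hAB fun a haA haB b hbB hbA => ih _ ?_ _ rfl
    have hsub : (swap a b • A).1 \ B.1 ⊂ A.1 \ B.1 := by
      simp only [Finset.ssubset_iff, Finset.subset_iff, Finset.mem_insert, Finset.mem_sdiff,
        mem_swap_smul_iff, swap_apply_def]
      exact ⟨a, by grind⟩
    exact hm ▸ Finset.card_lt_card hsub

theorem exists_notMem_of_card_lt {V ι : Type*} [Fintype ι] {x y : ι → V}
    (h : Function.Injective (Sum.elim x y))
    {S : Finset V} (hS : #S < Fintype.card ι) : ∃ l, x l ∉ S ∧ y l ∉ S := by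
  classical
  by_contra! hc
  obtain ⟨hx, hy, hxy⟩ := Sum.elim_injective.1 h
  refine hS.not_ge (Finset.card_le_card_of_injOn (fun l => if x l ∈ S then x l else y l) ?_ ?_)
  · intro l _
    grind
  · intro l _ m _ hlm
    grind [Function.Injective]

end Edges

section PermuteHom

theorem inner_eq_sum {V : Type*} [Fintype V] {k : ℕ} (w u : Weighting V k) :
    inner ℝ w u = ∑ A, w A * u A := by
  simp [PiLp.inner_apply, mul_comm]

variable {V : Type*} [Fintype V] [DecidableEq V] {k : ℕ}

/-- The representation of the symmetric group of `V` on the weightings, `π ↦ (w ↦ w_π)`. -/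
def permuteHom (V : Type*) [Fintype V] [DecidableEq V] (k : ℕ) :
    Perm V →* (Weighting V k ≃ₗᵢ[ℝ] Weighting V k) where
  toFun π := LinearIsometryEquiv.piLpCongrLeft 2 ℝ ℝ (MulAction.toPerm π)
  map_one' := by
    ext w A
    change w ((1 : Perm V)⁻¹ • A) = w A
    rw [inv_one, one_smul]
  map_mul' π σ := by
    ext w A
    change w ((π * σ)⁻¹ • A) = w (σ⁻¹ • π⁻¹ • A)
    rw [mul_inv_rev, mul_smul]

theorem permuteHom_apply (π : Perm V) (w : Weighting V k) (A : Set.powersetCard V k) :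
    permuteHom V k π w A = w (π⁻¹ • A) :=
  rfl

theorem permute_eq_permuteHom (π : Perm V) (w : Weighting V k) :
    permute π w = permuteHom V k π w := by
  ext A
  exact congrArg w (Subtype.ext (Finset.map_eq_image _ _))

theorem permuteHom_swap_apply (a b : V) (w : Weighting V k) (A : Set.powersetCard V k) :
    permuteHom V k (swap a b) w A = w (swap a b • A) := by
  rw [permuteHom_apply, swap_inv]

end PermuteHom

section PairWeighting

variable {V : Type*} [Fintype V] [DecidableEq V] {k : ℕ} {ι : Type*} [Fintype ι] {x y : ι → V}

/-- The product over `l` of `1[x l ∈ A] - 1[y l ∈ A]`, as a weighting of the `k`-subsets `A`. It is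
the canonical weighting `φ_i` of a sequence of `i` pairs, without reference to a fixed order. -/
def pairWeighting (k : ℕ) (x y : ι → V) : Weighting V k :=
  WithLp.toLp 2 fun A => ∏ l, ((if x l ∈ A.1 then 1 else 0) - (if y l ∈ A.1 then 1 else 0))

theorem pairWeighting_apply (x y : ι → V) (A : Set.powersetCard V k) :
    pairWeighting k x y A =
      ∏ l, ((if x l ∈ A.1 then 1 else 0) - (if y l ∈ A.1 then 1 else 0)) :=
  rfl

theorem permuteHom_pairWeighting (π : Perm V) (x y : ι → V) :
    permuteHom V k π (pairWeighting k x y) = pairWeighting k (π ∘ x) (π ∘ y) := by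
  ext A
  simp only [permuteHom_apply, pairWeighting_apply, mem_inv_smul_iff, Function.comp_apply]

theorem pairWeighting_apply_eq_zero_iff {A : Set.powersetCard V k} :
    pairWeighting k x y A = 0 ↔ ∃ l, (x l ∈ A.1 ↔ y l ∈ A.1) := by
  simp only [pairWeighting_apply, Finset.prod_eq_zero_iff, Finset.mem_univ, true_and, sub_eq_zero]
  exact exists_congr fun l => by split_ifs <;> simp [*]

theorem permuteHom_swap_pairWeighting (h : Function.Injective (Sum.elim x y)) (l : ι) :
    permuteHom V k (swap (x l) (y l)) (pairWeighting k x y) = -pairWeighting k x y := by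
  classical
  obtain ⟨hx, hy, hxy⟩ := Sum.elim_injective.1 h
  ext A
  rw [permuteHom_pairWeighting, PiLp.neg_apply, pairWeighting_apply, pairWeighting_apply,
    ← Finset.mul_prod_erase _ _ (Finset.mem_univ l),
    ← Finset.mul_prod_erase univ _ (Finset.mem_univ l), ← neg_mul]
  congr 1
  · simp
  · refine Finset.prod_congr rfl fun m hm => ?_
    have hml := Finset.ne_of_mem_erase hm
    simp only [Function.comp_apply, swap_apply_of_ne_of_ne (hx.ne hml) (hxy m l),
      swap_apply_of_ne_of_ne (hxy l m).symm (hy.ne hml)]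

theorem permuteHom_swap_pairWeighting_of_notMem {a b : V} (ha : a ∉ Set.range (Sum.elim x y))
    (hb : b ∉ Set.range (Sum.elim x y)) :
    permuteHom V k (swap a b) (pairWeighting k x y) = pairWeighting k x y := by
  have hfix : ∀ s, swap a b (Sum.elim x y s) = Sum.elim x y s := fun s =>
    swap_apply_of_ne_of_ne (fun e => ha ⟨s, e⟩) fun e => hb ⟨s, e⟩
  rw [permuteHom_pairWeighting, (funext fun l => hfix (.inl l) : swap a b ∘ x = x),
    (funext fun l => hfix (.inr l) : swap a b ∘ y = y)]

end PairWeighting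

section Determined

variable {V : Type*} [Fintype V] [DecidableEq V] {k : ℕ} {ι : Type*} [Fintype ι] {x y : ι → V}

theorem exists_swap_permuteHom_pairWeighting (h : Function.Injective (Sum.elim x y))
    {A B : Set.powersetCard V k} (hAB : A ≠ B) (hA : pairWeighting k x y A ≠ 0)
    (hB : pairWeighting k x y B ≠ 0) :
    ∃ a ∈ A.1, a ∉ B.1 ∧ ∃ b ∈ B.1, b ∉ A.1 ∧ ∃ c : ℝ, c ≠ 0 ∧
      permuteHom V k (swap a b) (pairWeighting k x y) = c • pairWeighting k x y := by
  rw [Ne, pairWeighting_apply_eq_zero_iff, not_exists] at hA hB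
  by_cases hl : ∃ l, ¬(x l ∈ A.1 ↔ x l ∈ B.1)
  · obtain ⟨l, hl⟩ := hl
    have hswap := permuteHom_swap_pairWeighting (k := k) h l
    rw [← neg_one_smul ℝ] at hswap
    by_cases hxA : x l ∈ A.1
    · exact ⟨x l, hxA, by grind, y l, by grind, by grind, -1, by norm_num, hswap⟩
    · exact ⟨y l, by grind, by grind, x l, by grind, hxA, -1, by norm_num,
        swap_comm (x l) (y l) ▸ hswap⟩
  · obtain ⟨a, haA, haB⟩ := (Set.powersetCard.exists_mem_notMem_iff_ne A B).1 hAB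
    obtain ⟨b, hbB, hbA⟩ := (Set.powersetCard.exists_mem_notMem_iff_ne B A).1 hAB.symm
    have hrange : ∀ v ∈ Set.range (Sum.elim x y), v ∈ A.1 ↔ v ∈ B.1 := by
      rintro _ ⟨l | l, rfl⟩ <;> grind
    refine ⟨a, haA, haB, b, hbB, hbA, 1, one_ne_zero, ?_⟩
    rw [one_smul]
    exact permuteHom_swap_pairWeighting_of_notMem (fun ha => haB ((hrange a ha).1 haA))
      fun hb => hbA ((hrange b hb).2 hbB)

theorem isDeterminedBySymmetries_pairWeighting (h : Function.Injective (Sum.elim x y)) :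
    IsDeterminedBySymmetries (permuteHom V k) (pairWeighting k x y) := by
  intro v hv
  rcases eq_or_ne (pairWeighting k x y) 0 with hp | hp
  · have hv0 : v = 0 := by simpa using hv 1 0 (by simp [hp])
    simp [hv0]
  obtain ⟨B, hB⟩ : ∃ B, pairWeighting k x y B ≠ 0 := by
    by_contra! hB
    exact hp (by ext A; exact hB A)
  have hprop : ∀ A, v A * pairWeighting k x y B = v B * pairWeighting k x y A := by
    refine swap_induction rfl fun A hAB ih => ?_
    by_cases hA : pairWeighting k x y A = 0
    · obtain ⟨l, hl⟩ := pairWeighting_apply_eq_zero_iff.1 hA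
      have hvA := congrArg (· A) (hv _ (-1) ((permuteHom_swap_pairWeighting h l).trans (by simp)))
      simp only [permuteHom_swap_apply, swap_smul_eq_self hl, PiLp.smul_apply,
        smul_eq_mul] at hvA
      linear_combination (1 / 2) * pairWeighting k x y B * hvA - v B * hA
    · obtain ⟨a, haA, haB, b, hbB, hbA, c, hc, hswap⟩ :=
        exists_swap_permuteHom_pairWeighting h hAB hA hB
      have hpA := congrArg (· A) hswap
      have hvA := congrArg (· A) (hv _ c hswap)
      have := ih a haA haB b hbB hbA
      simp only [permuteHom_swap_apply, PiLp.smul_apply, smul_eq_mul] at hpA hvA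
      rw [hpA, hvA] at this
      exact mul_left_cancel₀ hc (by linear_combination this)
  refine Submodule.mem_span_singleton.2 ⟨v B / pairWeighting k x y B, ?_⟩
  ext A
  rw [PiLp.smul_apply, smul_eq_mul, div_mul_eq_mul_div, div_eq_iff hB, hprop A]

end Determined

section ContainWeighting

variable {V : Type*} [Fintype V] [DecidableEq V] {k : ℕ} {ι : Type*} [Fintype ι] {x y : ι → V}

/-- The indicator weighting of the `k`-subsets that contain `S`. The choice `S = ∅` gives the
constant weighting `1`. -/
def containWeighting (k : ℕ) (S : Finset V) : Weighting V k :=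
  WithLp.toLp 2 fun A => if S ⊆ A.1 then 1 else 0

theorem pairWeighting_eq_sum_containWeighting [DecidableEq ι] (x y : ι → V) :
    pairWeighting k x y =
      ∑ t : Finset ι, (-1 : ℝ) ^ #t • containWeighting k (univ.image (t.piecewise y x)) := by
  ext A
  rw [pairWeighting_apply, Finset.prod_sub, Finset.powerset_univ]
  simp only [WithLp.ofLp_sum, Finset.sum_apply, PiLp.smul_apply, smul_eq_mul, mul_assoc]
  refine Finset.sum_congr rfl fun t _ => ?_
  rw [Finset.prod_ite_zero, Finset.prod_ite_zero]
  simp only [containWeighting, image_subset_iff, Finset.piecewise]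
  congr 1
  simp only [Finset.prod_const_one, ← ite_and, mul_ite, mul_one, mul_zero]
  refine if_congr ?_ rfl rfl
  simp only [Finset.mem_sdiff, Finset.mem_univ, true_and, forall_const]
  grind

theorem permuteHom_swap_containWeighting {a b : V} {S : Finset V} (ha : a ∉ S) (hb : b ∉ S) :
    permuteHom V k (swap a b) (containWeighting k S) = containWeighting k S := by
  ext A
  rw [permuteHom_swap_apply]
  refine if_congr (forall₂_congr fun v hv => ?_) rfl rfl
  rw [mem_swap_smul_iff, swap_apply_of_ne_of_ne] <;> grind

/- The swap of a pair `x l, y l` outside `S` fixes the first weighting and negates the second. -/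
theorem inner_containWeighting_pairWeighting (h : Function.Injective (Sum.elim x y))
    {S : Finset V} (hS : #S < Fintype.card ι) :
    inner ℝ (containWeighting k S) (pairWeighting k x y) = 0 := by
  obtain ⟨l, hx, hy⟩ := exists_notMem_of_card_lt h hS
  have hinner := (permuteHom V k (swap (x l) (y l))).inner_map_map (containWeighting k S)
    (pairWeighting k x y)
  rw [permuteHom_swap_containWeighting hx hy, permuteHom_swap_pairWeighting h,
    inner_neg_right] at hinner
  linarith

theorem inner_pairWeighting_of_card_lt {κ : Type*} [Fintype κ] (x' y' : κ → V)
    (h : Function.Injective (Sum.elim x y)) (hcard : Fintype.card κ < Fintype.card ι) :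
    inner ℝ (pairWeighting k x' y') (pairWeighting k x y) = 0 := by
  classical
  rw [pairWeighting_eq_sum_containWeighting, sum_inner]
  refine Finset.sum_eq_zero fun t _ => ?_
  rw [real_inner_smul_left, inner_containWeighting_pairWeighting h, mul_zero]
  exact Finset.card_image_le.trans_lt hcard

end ContainWeighting

section Pairs

variable {V : Type*}

theorem injective_sumElim_cons_iff {i : ℕ} {a b : V} {x y : Fin i → V} :
    Function.Injective (Sum.elim (Fin.cons a x : Fin (i + 1) → V) (Fin.cons b y)) ↔
      a ≠ b ∧ (∀ j, x j ≠ a ∧ x j ≠ b) ∧ (∀ j, y j ≠ a ∧ y j ≠ b) ∧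
        Function.Injective (Sum.elim x y) := by
  simp only [Sum.elim_injective, Fin.cons_injective_iff, Fin.forall_fin_succ, Fin.cons_zero,
    Fin.cons_succ, Set.mem_range, not_exists, forall_and]
  grind

theorem forall_injective_sumElim_succ_iff {i : ℕ}
    {P : (Fin (i + 1) → V) → (Fin (i + 1) → V) → Prop} :
    (∀ x y, Function.Injective (Sum.elim x y) → P x y) ↔
      ∀ a b, a ≠ b → ∀ x y : Fin i → {v : V // v ≠ a ∧ v ≠ b}, Function.Injective (Sum.elim x y) →
        P (Fin.cons a (Subtype.val ∘ x)) (Fin.cons b (Subtype.val ∘ y)) := by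
  refine ⟨fun H a b hab x y hxy => H _ _ ?_, fun H x y hxy => ?_⟩
  · refine injective_sumElim_cons_iff.2 ⟨hab, fun j => (x j).2, fun j => (y j).2, ?_⟩
    rw [← Sum.comp_elim]
    exact Subtype.val_injective.comp hxy
  · rw [← Fin.cons_self_tail x, ← Fin.cons_self_tail y] at hxy ⊢
    obtain ⟨hab, hx, hy, h⟩ := injective_sumElim_cons_iff.1 hxy
    refine H (x 0) (y 0) hab (fun j => ⟨_, hx j⟩) (fun j => ⟨_, hy j⟩)
      (Function.Injective.of_comp (f := Subtype.val) ?_)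
    rwa [Sum.comp_elim]

theorem exists_perm_comp_eq {ι : Type*} [Finite ι] {x y x' y' : ι → V}
    (h : Function.Injective (Sum.elim x y)) (h' : Function.Injective (Sum.elim x' y')) :
    ∃ π : Perm V, π ∘ x = x' ∧ π ∘ y = y' := by
  obtain ⟨π, hπ⟩ := Equiv.Perm.exists_extending_pair (Sum.elim x y) (Sum.elim x' y') h h'
  exact ⟨π, funext fun l => hπ (.inl l), funext fun l => hπ (.inr l)⟩

end Pairs

section AddVertex

variable {V : Type*} [DecidableEq V] {k : ℕ} {a b : V}

theorem mem_addVertex {e : Set.powersetCard {v : V // v ≠ a ∧ v ≠ b} k} {z : V}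
    {hz : z = a ∨ z = b} {v : V} :
    v ∈ (addVertex e z hz).1 ↔ v = z ∨ ∃ h : v ≠ a ∧ v ≠ b, ⟨v, h⟩ ∈ e.1 := by
  simp [addVertex]

theorem addVertex_injective {z : V} (hz : z = a ∨ z = b) :
    Function.Injective fun e : Set.powersetCard {v : V // v ≠ a ∧ v ≠ b} k =>
      addVertex e z hz := by
  intro e e' h
  refine Subtype.ext (Finset.ext fun v => ?_)
  have := congrArg (v.1 ∈ ·.1) h
  simp only [mem_addVertex] at this
  grind

theorem swap_smul_addVertex (hab : a ≠ b) (e : Set.powersetCard {v : V // v ≠ a ∧ v ≠ b} k) :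
    swap a b • addVertex e a (.inl rfl) = addVertex e b (.inr rfl) := by
  refine Subtype.ext (Finset.ext fun v => ?_)
  rw [mem_swap_smul_iff, mem_addVertex, mem_addVertex, swap_apply_def]
  grind

theorem exists_addVertex_eq {A : Set.powersetCard V (k + 1)} (ha : a ∈ A.1) (hb : b ∉ A.1) :
    ∃ e : Set.powersetCard {v : V // v ≠ a ∧ v ≠ b} k, addVertex e a (.inl rfl) = A := by
  have hmap : ((A.1.erase a).subtype fun v => v ≠ a ∧ v ≠ b).map (.subtype _) = A.1.erase a :=
    Finset.subtype_map_of_mem fun v hv => by grind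
  refine ⟨Set.powersetCard.ofCard (s := (A.1.erase a).subtype fun v => v ≠ a ∧ v ≠ b) ?_,
    Subtype.ext ?_⟩
  · rw [← Finset.card_map (.subtype _), hmap, Finset.card_erase_of_mem ha, A.2, Nat.add_sub_cancel]
  · refine Finset.ext fun v => ?_
    simp only [mem_addVertex, Set.powersetCard.val_ofCard, Finset.mem_subtype, Finset.mem_erase]
    grind

theorem sum_addVertex_add_addVertex [Fintype V] {M : Type*} [AddCommMonoid M] (hab : a ≠ b)
    {f : Set.powersetCard V (k + 1) → M} (hf : ∀ A, (a ∈ A.1 ↔ b ∈ A.1) → f A = 0) :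
    ∑ e : Set.powersetCard {v : V // v ≠ a ∧ v ≠ b} k,
      (f (addVertex e a (.inl rfl)) + f (addVertex e b (.inr rfl))) = ∑ A, f A := by
  rw [Finset.sum_add_distrib]
  refine (Fintype.sum_sum_type (Sum.elim _ _)).symm.trans <| Fintype.sum_of_injective
    (Sum.elim (addVertex · a (.inl rfl)) (addVertex · b (.inr rfl)))
    (Sum.elim_injective.2 ⟨addVertex_injective _, addVertex_injective _, fun e e' h => ?_⟩)
    _ _ (fun A hA => hf A ?_) (by rintro (e | e) <;> rfl)
  · have := congrArg (a ∈ ·.1) h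
    simp [mem_addVertex, hab] at this
  · by_contra hAab
    by_cases ha : a ∈ A.1
    · obtain ⟨e, rfl⟩ := exists_addVertex_eq (b := b) ha (by tauto)
      exact hA ⟨.inl e, rfl⟩
    · obtain ⟨e, he⟩ := exists_addVertex_eq (a := a) (b := b) (A := swap a b • A)
        (by rw [mem_swap_smul_iff, swap_apply_left]; tauto)
        (by rwa [mem_swap_smul_iff, swap_apply_right])
      refine hA ⟨.inr e, ?_⟩
      rw [Sum.elim_inr, ← swap_smul_addVertex hab, he, smul_smul, swap_mul_self, one_smul]

end AddVertex

section DiffWeighting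

variable {V : Type*} [Fintype V] [DecidableEq V] {k i : ℕ} {a b : V}

theorem pairWeighting_cons_apply (x y : Fin i → V) (A : Set.powersetCard V k) :
    pairWeighting k (Fin.cons a x : Fin (i + 1) → V) (Fin.cons b y) A =
      ((if a ∈ A.1 then 1 else 0) - (if b ∈ A.1 then 1 else 0)) * pairWeighting k x y A := by
  simp only [pairWeighting_apply, Fin.prod_univ_succ, Fin.cons_zero, Fin.cons_succ]

theorem pairWeighting_addVertex {ι : Type*} [Fintype ι] (x y : ι → {v : V // v ≠ a ∧ v ≠ b})
    (e : Set.powersetCard {v : V // v ≠ a ∧ v ≠ b} k) {z : V} (hz : z = a ∨ z = b) :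
    pairWeighting (k + 1) (Subtype.val ∘ x) (Subtype.val ∘ y) (addVertex e z hz) =
      pairWeighting k x y e := by
  have hmem (v : {v : V // v ≠ a ∧ v ≠ b}) : v.1 ∈ (addVertex e z hz).1 ↔ v ∈ e.1 := by
    rw [mem_addVertex]
    grind
  simp only [pairWeighting_apply, Function.comp_apply, hmem]

theorem inner_pairWeighting_cons (hab : a ≠ b) (x y : Fin i → {v : V // v ≠ a ∧ v ≠ b})
    (w : Weighting V (k + 1)) :
    inner ℝ (pairWeighting (k + 1) (Fin.cons a (Subtype.val ∘ x) : Fin (i + 1) → V)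
      (Fin.cons b (Subtype.val ∘ y))) w = inner ℝ (pairWeighting k x y) (diffWeighting w a b) := by
  rw [inner_eq_sum, inner_eq_sum, ← sum_addVertex_add_addVertex hab]
  · refine Finset.sum_congr rfl fun e _ => ?_
    simp only [pairWeighting_cons_apply, pairWeighting_addVertex, diffWeighting]
    simp [mem_addVertex, hab, hab.symm]
    ring
  · intro A hA
    simp [pairWeighting_cons_apply, hA]

end DiffWeighting

section WVector

theorem density_eq_zero_iff {V : Type*} [Fintype V] {k : ℕ} {w : Weighting V k} :
    density w = 0 ↔ ∑ A, w A = 0 := by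
  rw [density, div_eq_zero_iff, or_iff_left_iff_imp, Nat.cast_eq_zero, ← Nat.card_eq_fintype_card,
    ← Set.powersetCard.card, Finite.card_eq_zero_iff]
  exact fun _ => Fintype.sum_empty _

theorem wVector_nonneg : ∀ (i : ℕ) {k : ℕ} {V : Type u} [Fintype V] [DecidableEq V]
    (w : Weighting V k), 0 ≤ wVector i w
  | 0, _, _, _, _, w => by
    rw [wVector]
    exact abs_nonneg _
  | _ + 1, 0, _, _, _, _ => by rw [wVector]
  | i + 1, _ + 1, V, _, _, w => by
    rw [wVector]
    refine div_nonneg (Finset.sum_nonneg fun a _ => Finset.sum_nonneg fun b _ => ?_) ?_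
    · exact ite_nonneg (wVector_nonneg i _) le_rfl
    · rcases Nat.eq_zero_or_pos (Fintype.card V) with hV | hV
      · simp [hV]
      · exact mul_nonneg (Nat.cast_nonneg _) (sub_nonneg.2 (mod_cast hV))

theorem wVector_succ_eq_zero_iff {i k : ℕ} {V : Type u} [Fintype V] [DecidableEq V]
    {w : Weighting V (k + 1)} :
    wVector (i + 1) w = 0 ↔ ∀ a b, a ≠ b → wVector i (diffWeighting w a b) = 0 := by
  have hterm (a b : V) : 0 ≤ if a ≠ b then wVector i (diffWeighting w a b) else 0 :=
    ite_nonneg (wVector_nonneg i _) le_rfl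
  rw [wVector, div_eq_zero_iff, Finset.sum_eq_zero_iff_of_nonneg fun a _ =>
    Finset.sum_nonneg fun b _ => hterm a b]
  simp only [Finset.sum_eq_zero_iff_of_nonneg fun b _ => hterm _ b, Finset.mem_univ, true_imp_iff,
    ite_eq_right_iff]
  refine or_iff_left_of_imp fun hV a b hab => absurd hV ?_
  have hcard : (1 : ℝ) < Fintype.card V :=
    mod_cast Fintype.one_lt_card_iff.2 ⟨a, b, hab⟩
  exact (mul_pos (by linarith) (by linarith)).ne'

theorem inner_pairWeighting_of_isEmpty {V ι : Type*} [Fintype V] [DecidableEq V] [Fintype ι]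
    [IsEmpty ι] {k : ℕ} (x y : ι → V) (w : Weighting V k) :
    inner ℝ (pairWeighting k x y) w = ∑ A, w A := by
  simp [inner_eq_sum, pairWeighting_apply]

theorem wVector_eq_zero_iff : ∀ {i k : ℕ} {V : Type u} [Fintype V] [DecidableEq V]
    {w : Weighting V k}, wVector i w = 0 ↔ ∀ x y : Fin i → V,
      Function.Injective (Sum.elim x y) → inner ℝ (pairWeighting k x y) w = 0
  | 0, _, _, _, _, w => by
    simp only [wVector, abs_eq_zero, density_eq_zero_iff, inner_pairWeighting_of_isEmpty]
    exact ⟨fun h _ _ _ => h, fun h => h Fin.elim0 Fin.elim0 (Function.injective_of_subsingleton _)⟩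
  | i + 1, 0, _, _, _, w => by
    refine iff_of_true (by rw [wVector]) fun x y _ => ?_
    have hzero : pairWeighting 0 x y = 0 := by
      ext A
      refine pairWeighting_apply_eq_zero_iff.2 ⟨0, ?_⟩
      simp [Finset.card_eq_zero.1 A.2]
    rw [hzero, inner_zero_left]
  | i + 1, k + 1, _, _, _, w => by
    rw [wVector_succ_eq_zero_iff, forall_injective_sumElim_succ_iff]
    refine forall₃_congr fun a b hab => ?_
    simp only [wVector_eq_zero_iff, inner_pairWeighting_cons hab]

theorem apply_swap_smul_of_diffWeighting_eq_zero {V : Type*} [Fintype V] [DecidableEq V] {k : ℕ}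
    {w : Weighting V (k + 1)} {a b : V} (hw : diffWeighting w a b = 0)
    {A : Set.powersetCard V (k + 1)} (ha : a ∈ A.1) (hb : b ∉ A.1) : w (swap a b • A) = w A := by
  obtain ⟨e, rfl⟩ := exists_addVertex_eq ha hb
  rw [swap_smul_addVertex (by rintro rfl; exact hb ha)]
  exact (sub_eq_zero.1 (congrArg (· e) hw)).symm

theorem eq_zero_of_forall_apply_eq_of_density_eq_zero {V : Type*} [Fintype V] {k : ℕ}
    {w : Weighting V k} (hconst : ∀ A B, w A = w B) (hw : density w = 0) : w = 0 := by
  ext A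
  rw [density_eq_zero_iff, Finset.sum_congr rfl fun B _ => hconst B A, Finset.sum_const,
    smul_eq_zero] at hw
  exact hw.resolve_left (Finset.card_ne_zero_of_mem (Finset.mem_univ A))

theorem eq_zero_of_wVector_eq_zero : ∀ {k : ℕ} {V : Type u} [Fintype V] [DecidableEq V]
    {w : Weighting V k}, (∀ i ≤ k, wVector i w = 0) → w = 0
  | k, V, _, _, w, h => by
    refine eq_zero_of_forall_apply_eq_of_density_eq_zero (fun A B => ?_)
      (by simpa [wVector] using h 0 (Nat.zero_le k))
    refine swap_induction (P := fun A => w A = w B) rfl (fun A hAB ih => ?_) A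
    obtain ⟨a, ha, ha'⟩ := (Set.powersetCard.exists_mem_notMem_iff_ne A B).1 hAB
    obtain ⟨b, hb, hb'⟩ := (Set.powersetCard.exists_mem_notMem_iff_ne B A).1 hAB.symm
    cases k with
    | zero => simp [Finset.card_eq_zero.1 A.2, Finset.card_eq_zero.1 B.2, Subtype.ext_iff] at hAB
    | succ k =>
      rw [← apply_swap_smul_of_diffWeighting_eq_zero _ ha hb', ih a ha ha' b hb hb']
      refine eq_zero_of_wVector_eq_zero fun i hi => ?_
      exact wVector_succ_eq_zero_iff.1 (h _ (Nat.succ_le_succ hi)) a b (by grind)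

end WVector

section CanonicalSpan

variable {V : Type*} [Fintype V] [DecidableEq V] {k : ℕ}

theorem card_inter_pair_eq_one_iff {α : Type*} [DecidableEq α] {a b : α} (hab : a ≠ b)
    {S : Finset α} : #(S ∩ {a, b}) = 1 ↔ ¬(a ∈ S ↔ b ∈ S) := by
  by_cases ha : a ∈ S <;> by_cases hb : b ∈ S <;> simp [ha, hb, hab, Finset.inter_insert_of_mem,
    Finset.inter_insert_of_notMem]

theorem pairWeighting_apply_eq_neg_one_pow {ι : Type*} [Fintype ι] {x y : ι → V}
    (hy : Function.Injective y) {A : Set.powersetCard V k} (hA : ∀ l, ¬(x l ∈ A.1 ↔ y l ∈ A.1)) :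
    pairWeighting k x y A = (-1) ^ #(A.1 ∩ univ.image y) := by
  have himage : A.1 ∩ univ.image y = (univ.filter fun l => y l ∈ A.1).image y := by
    ext
    grind
  calc pairWeighting k x y A = ∏ l, if y l ∈ A.1 then -1 else 1 :=
        Finset.prod_congr rfl fun l _ => by have := hA l; split_ifs <;> simp_all
    _ = (-1) ^ #(A.1 ∩ univ.image y) := by
        rw [Finset.prod_ite, Finset.prod_const, Finset.prod_const_one, mul_one, himage,
          Finset.card_image_of_injective _ hy]

theorem injective_sumElim_castLE {V : Type*} {k : ℕ} {x y : Fin k → V}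
    (h : Function.Injective (Sum.elim x y)) {i : ℕ} (hi : i ≤ k) :
    Function.Injective (Sum.elim (x ∘ Fin.castLE hi) (y ∘ Fin.castLE hi)) := by
  rw [← Sum.elim_comp_map]
  exact h.comp ((Fin.castLE_injective hi).sumMap (Fin.castLE_injective hi))

variable {x y : Fin k → V}

theorem phi_eq_pairWeighting (h : Function.Injective (Sum.elim x y)) (i : Fin (k + 1)) :
    phi x y i = pairWeighting k (x ∘ Fin.castLE i.is_le) (y ∘ Fin.castLE i.is_le) := by
  have hcast {P : Fin k → Prop} :
      (∀ j : Fin k, (j : ℕ) < i → P j) ↔ ∀ l : Fin i, P (Fin.castLE i.is_le l) :=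
    ⟨fun H l => H _ l.2, fun H j hj => H ⟨j, hj⟩⟩
  have himage : (univ.filter fun j : Fin k => (j : ℕ) < i).image y =
      univ.image (y ∘ Fin.castLE i.is_le) := by
    rw [← Finset.image_image]
    congr 1
    ext j
    simpa using ⟨fun hj => ⟨⟨j, hj⟩, rfl⟩, by rintro ⟨l, rfl⟩; exact l.2⟩
  obtain ⟨-, hy, hxy⟩ := Sum.elim_injective.1 h
  ext A
  simp only [phi, hcast, himage, card_inter_pair_eq_one_iff (hxy _ _)]
  split_ifs with hA
  · exact (pairWeighting_apply_eq_neg_one_pow (hy.comp (Fin.castLE_injective _)) hA).symm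
  · exact (pairWeighting_apply_eq_zero_iff.2 (by simpa using hA)).symm

theorem canonicalSpan_eq_orbitSpan (x y : Fin k → V) (i : Fin (k + 1)) :
    canonicalSpan x y i = orbitSpan (permuteHom V k) (phi x y i) := by
  simp only [canonicalSpan, orbitSpan, permute_eq_permuteHom]

theorem mem_orthogonal_canonicalSpan_iff (h : Function.Injective (Sum.elim x y))
    {i : Fin (k + 1)} {w : Weighting V k} :
    w ∈ (canonicalSpan x y i)ᗮ ↔ ∀ x' y' : Fin i → V, Function.Injective (Sum.elim x' y') →
      inner ℝ (pairWeighting k x' y') w = 0 := by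
  have h' := injective_sumElim_castLE h i.is_le
  simp only [canonicalSpan_eq_orbitSpan, mem_orthogonal_orbitSpan_iff, phi_eq_pairWeighting h,
    permuteHom_pairWeighting]
  refine ⟨fun H x' y' hxy' => ?_, fun H π => H _ _ ?_⟩
  · obtain ⟨π, rfl, rfl⟩ := exists_perm_comp_eq h' hxy'
    exact H π
  · rw [← Sum.comp_elim]
    exact π.injective.comp h'

theorem mem_orthogonal_canonicalSpan_iff_wVector_eq_zero (h : Function.Injective (Sum.elim x y))
    {i : Fin (k + 1)} {w : Weighting V k} :
    w ∈ (canonicalSpan x y i)ᗮ ↔ wVector (i : ℕ) w = 0 :=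
  (mem_orthogonal_canonicalSpan_iff h).trans wVector_eq_zero_iff.symm

theorem pairwise_canonicalSpan_isOrtho (h : Function.Injective (Sum.elim x y)) :
    Pairwise fun i j => canonicalSpan x y i ⟂ canonicalSpan x y j := by
  suffices hlt : ∀ i j, i < j → canonicalSpan x y i ⟂ canonicalSpan x y j by
    intro i j hij
    exact hij.lt_or_gt.elim (hlt i j) fun hji => (hlt j i hji).symm
  intro i j hij
  refine Submodule.span_le.2 (Set.range_subset_iff.2 fun π => ?_)
  refine (mem_orthogonal_canonicalSpan_iff h).2 fun x' y' hxy' => ?_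
  rw [permute_eq_permuteHom, phi_eq_pairWeighting h, permuteHom_pairWeighting, real_inner_comm]
  exact inner_pairWeighting_of_card_lt _ _ hxy' (by simpa using hij)

theorem phi_mem_canonicalSpan (x y : Fin k → V) (i : Fin (k + 1)) :
    phi x y i ∈ canonicalSpan x y i :=
  canonicalSpan_eq_orbitSpan x y i ▸ self_mem_orbitSpan _

theorem density_eq_zero_of_mem_canonicalSpan (h : Function.Injective (Sum.elim x y))
    {i : Fin (k + 1)} (hi : i ≠ 0) {w : Weighting V k} (hw : w ∈ canonicalSpan x y i) :
    density w = 0 := by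
  have hW := (mem_orthogonal_canonicalSpan_iff_wVector_eq_zero h).1
    (pairwise_canonicalSpan_isOrtho h hi hw)
  rwa [Fin.val_zero, wVector, abs_eq_zero] at hW

theorem isInternal_canonicalSpan (h : Function.Injective (Sum.elim x y)) :
    DirectSum.IsInternal (canonicalSpan x y) := by
  refine (OrthogonalFamily.isInternal_iff
    (OrthogonalFamily.of_pairwise (pairwise_canonicalSpan_isOrtho h))).2 ?_
  rw [eq_bot_iff, ← Submodule.iInf_orthogonal]
  refine fun w hw => (Submodule.mem_bot ℝ).2 (eq_zero_of_wVector_eq_zero fun i hi => ?_)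
  exact (mem_orthogonal_canonicalSpan_iff_wVector_eq_zero (i := ⟨i, Nat.lt_succ_of_le hi⟩) h).1
    ((Submodule.mem_iInf _).1 hw _)

end CanonicalSpan

section Disc

variable {V : Type*} [Fintype V] [DecidableEq V] {k : ℕ} {w u : Weighting V k}

theorem disc_eq_zero_iff_forall_inner : disc w u = 0 ↔ ∀ π, inner ℝ (permuteHom V k π w) u =
    density w * density u * (Fintype.card V).choose k := by
  have hle (π : Perm V) := Finset.le_sup' (fun π : Perm V => |inner ℝ (permute π w) u -
    density w * density u * (Fintype.card V).choose k|) (Finset.mem_univ π)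
  have hnonneg : 0 ≤ disc w u := (abs_nonneg _).trans (hle 1)
  rw [← hnonneg.ge_iff_eq', disc, Finset.sup'_le_iff]
  simp [sub_eq_zero, permute_eq_permuteHom]

theorem inner_containWeighting_empty :
    inner ℝ (containWeighting k ∅) w = density w * (Fintype.card V).choose k := by
  have hsum : inner ℝ (containWeighting k ∅) w = ∑ A, w A := by
    simp [inner_eq_sum, containWeighting]
  rw [hsum]
  by_cases hz : ((Fintype.card V).choose k : ℝ) = 0
  · rw [hz, mul_zero, ← density_eq_zero_iff, density, hz, div_zero]
  · rw [density, div_mul_cancel₀ _ hz]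

theorem permuteHom_containWeighting_empty (π : Perm V) :
    permuteHom V k π (containWeighting k ∅) = containWeighting k ∅ := by
  ext A
  simp [permuteHom_apply, containWeighting]

theorem disc_eq_zero_iff_mem_orthogonal : disc w u = 0 ↔
    w ∈ (orbitSpan (permuteHom V k) (u - density u • containWeighting k ∅))ᗮ := by
  rw [mem_orthogonal_orbitSpan_comm, mem_orthogonal_orbitSpan_iff, disc_eq_zero_iff_forall_inner]
  refine forall_congr' fun π => ?_
  rw [inner_sub_right, real_inner_smul_right, inner_apply_left _ w (containWeighting k ∅),
    permuteHom_containWeighting_empty, real_inner_comm (containWeighting k ∅),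
    inner_containWeighting_empty, sub_eq_zero, mul_assoc, mul_left_comm]

variable {x y : Fin k → V} (h : Function.Injective (Sum.elim x y))
include h

theorem disc_phi_eq_zero_iff {i : Fin (k + 1)} (hi : i ≠ 0) :
    disc w (phi x y i) = 0 ↔ w ∈ (canonicalSpan x y i)ᗮ := by
  rw [disc_eq_zero_iff_mem_orthogonal, canonicalSpan_eq_orbitSpan,
    density_eq_zero_of_mem_canonicalSpan h hi (phi_mem_canonicalSpan x y i), zero_smul, sub_zero]

theorem disc_eq_zero_of_mem_canonicalSpan {i j : Fin (k + 1)} (hij : i ≠ j)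
    (hw : w ∈ canonicalSpan x y i) (hu : u ∈ canonicalSpan x y j) : disc w u = 0 := by
  have hdensity : density w * density u = 0 := by
    rcases eq_or_ne i 0 with rfl | hi
    · rw [density_eq_zero_of_mem_canonicalSpan h hij.symm hu, mul_zero]
    · rw [density_eq_zero_of_mem_canonicalSpan h hi hw, zero_mul]
  rw [disc_eq_zero_iff_forall_inner, hdensity, zero_mul]
  rw [canonicalSpan_eq_orbitSpan] at hw
  refine fun π => (pairwise_canonicalSpan_isOrtho h hij).inner_eq ?_ hu
  exact canonicalSpan_eq_orbitSpan x y i ▸ map_mem_orbitSpan π hw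

theorem containWeighting_empty_mem_orthogonal_canonicalSpan {i : Fin (k + 1)} (hi : i ≠ 0) :
    containWeighting k ∅ ∈ (canonicalSpan x y i)ᗮ := by
  refine (mem_orthogonal_canonicalSpan_iff h).2 fun x' y' hxy' => ?_
  rw [real_inner_comm]
  exact inner_containWeighting_pairWeighting hxy' (by simpa [Nat.pos_iff_ne_zero] using hi)

theorem mem_orthogonal_or_mem_orthogonal_of_disc_eq_zero (hdisc : disc w u = 0) {i : Fin (k + 1)}
    (hi : i ≠ 0) : w ∈ (canonicalSpan x y i)ᗮ ∨ u ∈ (canonicalSpan x y i)ᗮ := by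
  have hφ : IsDeterminedBySymmetries (permuteHom V k) (phi x y i) :=
    phi_eq_pairWeighting h i ▸
      isDeterminedBySymmetries_pairWeighting (injective_sumElim_castLE h i.is_le)
  have hone := Submodule.smul_mem _ (density u)
    (containWeighting_empty_mem_orthogonal_canonicalSpan h hi)
  rw [canonicalSpan_eq_orbitSpan] at hone ⊢
  rw [disc_eq_zero_iff_mem_orthogonal] at hdisc
  rcases mem_orthogonal_orbitSpan_or_orbitSpan_le hφ (u - density u • containWeighting k ∅)
    with hu | hle
  · exact .inr ((Submodule.sub_mem_iff_left _ hone).1 hu)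
  · exact .inl (Submodule.orthogonal_le hle hdisc)

theorem exists_partition_of_disc_eq_zero {ι : Type*} [Nonempty ι] {w : ι → Weighting V k}
    (hw : Pairwise fun i j => disc (w i) (w j) = 0) :
    ∃ I : ι → Set (Fin (k + 1)),
      Pairwise (Function.onFun Disjoint I) ∧ (⋃ i, I i) = {j | j ≠ 0} ∧
        ∀ i, w i ∈ canonicalSpan x y 0 ⊔ ⨆ j ∈ I i, canonicalSpan x y j := by
  have howner (j : Fin (k + 1)) :
      ∃ owner, j ≠ 0 → ∀ i, w i ∉ (canonicalSpan x y j)ᗮ → i = owner := by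
    by_cases hj : ∃ i, w i ∉ (canonicalSpan x y j)ᗮ
    · obtain ⟨i, hi⟩ := hj
      refine ⟨i, fun hj0 i' hi' => of_not_not fun hii' => ?_⟩
      exact (mem_orthogonal_or_mem_orthogonal_of_disc_eq_zero h (hw hii') hj0).elim hi' hi
    · exact ⟨Classical.arbitrary ι, fun _ i hi => absurd ⟨i, hi⟩ hj⟩
  choose owner howner using howner
  refine ⟨fun i => {j | j ≠ 0 ∧ i = owner j}, fun i i' hii' => ?_, by ext; simp, fun i => ?_⟩
  · exact Set.disjoint_left.2 fun j hj hj' => hii' (hj.2.trans hj'.2.symm)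
  · refine mem_of_forall_notMem_orthogonal_le (pairwise_canonicalSpan_isOrtho h)
      (isInternal_canonicalSpan h).submodule_iSup_eq_top fun j hj => ?_
    rcases eq_or_ne j 0 with rfl | hj0
    · exact le_sup_left
    · exact le_sup_of_le_right (le_iSup₂_of_le j ⟨hj0, howner j hj0 i hj⟩ le_rfl)

end Disc

end

end WHyp

theorem theorem5 {V : Type*} [Fintype V] [DecidableEq V] (k : ℕ) (hk : 1 ≤ k)
    (hn : 2 * k ≤ Fintype.card V) (x y : Fin k → V)
    (hxy : Function.Injective (Sum.elim x y)) :
    -- (a)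
    (∀ (i : Fin (k + 1)) (w : WHyp.Weighting V k), i ≠ 0 →
      (WHyp.disc w (WHyp.phi x y i) = 0 ↔ w ∈ (WHyp.canonicalSpan x y i)ᗮ)) ∧
    -- (b)
    (∀ (i j : Fin (k + 1)) (u w : WHyp.Weighting V k), i ≠ j →
      u ∈ WHyp.canonicalSpan x y i → w ∈ WHyp.canonicalSpan x y j → WHyp.disc u w = 0) ∧
    -- (c)
    DirectSum.IsInternal (WHyp.canonicalSpan x y) ∧
    -- (d)
    (∀ (u : WHyp.Weighting V k) (c : Fin (k + 1) → WHyp.Weighting V k),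
      (∀ i, c i ∈ WHyp.canonicalSpan x y i) → u = ∑ i, c i →
      ∀ i : Fin (k + 1), WHyp.wVector (i : ℕ) u = 0 ↔ c i = 0) ∧
    -- (e)
    (∀ (t : ℕ) (w : Fin t → WHyp.Weighting V k), 1 ≤ t → (∀ i, w i ≠ 0) →
      (∀ i j, i ≠ j → WHyp.disc (w i) (w j) = 0) →
      ∃ I : Fin t → Set (Fin (k + 1)),
        Pairwise (Function.onFun Disjoint I) ∧ (⋃ i, I i) = {h | h ≠ 0} ∧
        ∀ i, w i ∈ WHyp.canonicalSpan x y 0 ⊔ ⨆ h ∈ I i, WHyp.canonicalSpan x y h) := by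
  refine ⟨fun _ _ hi => WHyp.disc_phi_eq_zero_iff hxy hi,
    fun _ _ _ _ hij hu hw => WHyp.disc_eq_zero_of_mem_canonicalSpan hxy hij hu hw,
    WHyp.isInternal_canonicalSpan hxy, fun u c hc hu i => ?_, fun t w ht _ hdisc => ?_⟩
  · rw [← WHyp.mem_orthogonal_canonicalSpan_iff_wVector_eq_zero hxy, hu]
    exact WHyp.sum_mem_orthogonal_iff (WHyp.pairwise_canonicalSpan_isOrtho hxy) hc i
  · have : Nonempty (Fin t) := ⟨⟨0, ht⟩⟩
    exact WHyp.exists_partition_of_disc_eq_zero hxy hdisc
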